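/- All rings are commutative with identity. For a ring $A$ and an $A$-module $E$, the trivial ring extension $A \propto E$ is the ring with underlying additive group $A \times E$ and multiplication $(a,e)(a',e') = (aa', ae' + a'e)$. For a polynomial $f$ over a ring $R$, let $c(f)$ be its content, that is, the ideal of $R$ generated by the coefficients of $f$. The polynomial $f$ is called Gaussian if $c(fg) = c(f)c(g)$ for every $g \in R[x]$. An ideal $I$ of $R$ is locally principal if $IR_P$ is a principal ideal of $R_P$ for every maximal ideal $P$ of $R$. The ring $R$ is called pseudo-arithmetical if every Gaussian polynomial over $R$ has locally principal content ideal. (1) Let $A$ be an integral domain with quotient field $K$. Then the trivial ring extension $A \propto K$ is pseudo-arithmetical. (2) Let $A \subseteq B$ be an extension of rings. If $A \propto B$ is pseudo-arithmetical, then so is $A$. -/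

import Mathlib

/-- A polynomial `f` over `R` is Gaussian if `c(fg) = c(f)c(g)` for every polynomial `g` over `R`,
where `c` denotes the content ideal. -/
def Polynomial.IsGaussian {R : Type*} [CommRing R] (f : Polynomial R) : Prop :=
  ∀ g : Polynomial R, (f * g).contentIdeal = f.contentIdeal * g.contentIdeal

/-- An ideal is locally principal if its extension to the localization at each maximal ideal is
principal. -/
def Ideal.IsLocallyPrincipal {R : Type*} [CommRing R] (I : Ideal R) : Prop :=
  ∀ (P : Ideal R) [P.IsMaximal],
    (I.map (algebraMap R (Localization.AtPrime P))).IsPrincipal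

/-- A commutative ring is pseudo-arithmetical if every Gaussian polynomial over it has locally
principal content ideal. -/
def IsPseudoArithmetical (R : Type*) [CommRing R] : Prop :=
  ∀ f : Polynomial R, f.IsGaussian → f.contentIdeal.IsLocallyPrincipal

/-! With `π` the projection to `A`, the identity `(0, f) * G = (0, f * π(G))` makes `(0, f)` over `A
∝ B` and `f` over `A` Gaussian together; their contents are also locally principal together. This
gives (2). For (1), a Gaussian `F` over `A ∝ K` with `π(F) = 0` becomes some `(0, f)` once
denominators are cleared. If `π(F) ≠ 0`, local principality lifts from `c(π(F))` to `c(F)`, because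
nonzero elements of `A` act invertibly on `K`. Both cases need that Gaussian polynomials over a
domain have locally principal content.

Localizing, let `R` be a local domain and `f ≠ 0` Gaussian. Graeffe's identity bounds the number of
generators of `c(f) ^ 2 ^ k` by `deg f + 1` for all `k`. Hence, in a valuation ring dominating `R`,
the roots of `f` have algebraic residues (`isAlgebraic_residue_of_root`). If `f` divided no
polynomial with a unit coefficient over the fraction field, a dominating valuation ring would
contain a root of `f` with transcendental residue. So `f * g = d * N` with `c(N) = R` and `d ≠ 0`;
then `c(f) c(g) = (d)` is invertible, and `c(f)` is principal by locality. -/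

open Polynomial IsLocalRing

/-! ### Content ideals and permanence of the Gaussian property -/

namespace Polynomial

variable {R S : Type*} [CommRing R] [CommRing S]

theorem contentIdeal_le_iff {f : R[X]} {I : Ideal R} :
    f.contentIdeal ≤ I ↔ ∀ n, f.coeff n ∈ I := by
  refine ⟨fun h n => h (f.coeff_mem_contentIdeal n), fun h => ?_⟩
  rw [contentIdeal_def, Ideal.span_le]
  intro r hr
  obtain ⟨n, -, rfl⟩ := mem_coeffs_iff.mp (Finset.mem_coe.mp hr)
  exact h n

theorem contentIdeal_C_mul (r : R) (f : R[X]) :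
    (C r * f).contentIdeal = Ideal.span {r} * f.contentIdeal := by
  refine le_antisymm ((contentIdeal_mul_le_mul_contentIdeal _ _).trans_eq (by simp)) ?_
  rw [contentIdeal_def f, Ideal.span_mul_span', Ideal.span_le]
  rintro _ ⟨x, rfl, y, hy, rfl⟩
  obtain ⟨n, -, rfl⟩ := mem_coeffs_iff.mp (Finset.mem_coe.mp hy)
  simpa using (C x * f).coeff_mem_contentIdeal n

theorem contentIdeal_expand (f : R[X]) {n : ℕ} (hn : 0 < n) :
    (expand R n f).contentIdeal = f.contentIdeal := by
  apply le_antisymm <;> rw [contentIdeal_le_iff] <;> intro i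
  · rw [coeff_expand hn]
    split_ifs
    · exact coeff_mem_contentIdeal _ _
    · exact zero_mem _
  · rw [← coeff_expand_mul hn f i]
    exact coeff_mem_contentIdeal _ _

theorem contentIdeal_comp_neg_X (f : R[X]) : (f.comp (-X)).contentIdeal = f.contentIdeal := by
  have key : ∀ f : R[X], (f.comp (-X)).contentIdeal ≤ f.contentIdeal := fun f => by
    rw [contentIdeal_le_iff]
    intro n
    rw [show (-X : R[X]) = C (-1) * X by simp, comp_C_mul_X_coeff]
    exact Ideal.mul_mem_right _ _ (coeff_mem_contentIdeal _ _)
  refine le_antisymm (key f) ?_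
  simpa [comp_assoc] using key (f.comp (-X))

theorem span_coeff_eq_contentIdeal {f : R[X]} {n : ℕ} (hn : f.natDegree ≤ n) :
    Ideal.span (Set.range fun i : Fin (n + 1) => f.coeff i) = f.contentIdeal := by
  apply le_antisymm
  · rw [Ideal.span_le]
    rintro _ ⟨i, rfl⟩
    exact coeff_mem_contentIdeal _ _
  · rw [contentIdeal_le_iff]
    intro i
    by_cases hi : i < n + 1
    · exact Ideal.subset_span ⟨⟨i, hi⟩, rfl⟩
    · rw [coeff_eq_zero_of_natDegree_lt (by omega)]
      exact zero_mem _

/-- Graeffe's identity: `f(X) f(-X)` is a polynomial in `X ^ 2`. -/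
theorem exists_mul_comp_neg_X_eq_expand (f : R[X]) :
    ∃ q : R[X], f * f.comp (-X) = expand R 2 q := by
  -- Even and odd parts: `f = a(X²) + X b(X²)`, so `f(X) f(-X) = a(X²)² - X² b(X²)²`.
  have hf : f = expand R 2 (contract 2 f) + X * expand R 2 (contract 2 f.divX) := by
    ext n
    rcases n with _ | n
    · simp [coeff_expand, coeff_contract]
    · rw [coeff_add, coeff_X_mul, coeff_expand two_pos, coeff_expand two_pos,
        coeff_contract two_ne_zero, coeff_contract two_ne_zero]
      by_cases h : 2 ∣ n
      · have h' : ¬ 2 ∣ n + 1 := by omega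
        simp [h, h', Nat.div_mul_cancel h]
      · have h' : 2 ∣ n + 1 := by omega
        simp only [h, h', if_true, if_false, Nat.div_mul_cancel h', add_zero]
  have hneg : ∀ p : R[X], (expand R 2 p).comp (-X) = expand R 2 p := fun p => by
    simp [expand_eq_comp_X_pow, comp_assoc]
  refine ⟨contract 2 f ^ 2 - X * contract 2 f.divX ^ 2, ?_⟩
  generalize contract 2 f = a at *
  generalize contract 2 f.divX = b at *
  rw [hf]
  simp only [add_comp, mul_comp, X_comp, hneg, map_sub, map_mul, map_pow, expand_X]
  ring

namespace IsGaussian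

theorem mul {f g : R[X]} (hf : f.IsGaussian) (hg : g.IsGaussian) : (f * g).IsGaussian := by
  intro h
  rw [mul_assoc, hf, hg, hf, mul_assoc]

theorem comp_neg_X {f : R[X]} (hf : f.IsGaussian) : (f.comp (-X)).IsGaussian := by
  intro g
  have : f.comp (-X) * g = (f * g.comp (-X)).comp (-X) := by simp [comp_assoc]
  rw [this, contentIdeal_comp_neg_X, hf, contentIdeal_comp_neg_X, contentIdeal_comp_neg_X]

theorem C_mul {f : R[X]} (hf : f.IsGaussian) (r : R) : (C r * f).IsGaussian := by
  intro g
  rw [mul_assoc, contentIdeal_C_mul, contentIdeal_C_mul, hf, mul_assoc]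

theorem of_expand {f : R[X]} {n : ℕ} (hn : 0 < n) (hf : (expand R n f).IsGaussian) :
    f.IsGaussian := by
  intro g
  rw [← contentIdeal_expand _ hn, map_mul, hf, contentIdeal_expand _ hn, contentIdeal_expand _ hn]

theorem map_of_surjective {f : R[X]} (hf : f.IsGaussian) (φ : R →+* S)
    (hφ : Function.Surjective φ) : (f.map φ).IsGaussian := by
  intro g
  obtain ⟨g, rfl⟩ := map_surjective φ hφ g
  rw [← Polynomial.map_mul]
  simp only [contentIdeal_map_eq_map_contentIdeal]
  rw [hf, Ideal.map_mul]

/-- Clearing the denominators of a test polynomial multiplies it by a unit of `S`, which does not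
change contents. -/
theorem map_isLocalization {f : R[X]} (hf : f.IsGaussian) (M : Submonoid R) [Algebra R S]
    [IsLocalization M S] : (f.map (algebraMap R S)).IsGaussian := by
  intro g
  obtain ⟨s, hs, h⟩ := IsLocalization.integerNormalization_spec M g
  set g' := IsLocalization.integerNormalization M g
  have hs' : IsUnit (algebraMap R S s) := IsLocalization.map_units S ⟨s, hs⟩
  have hmap : g'.map (algebraMap R S) = C (algebraMap R S s) * g := by
    rw [h]
    ext n
    simp [Algebra.smul_def]
  have hC : ∀ p : S[X], (C (algebraMap R S s) * p).contentIdeal = p.contentIdeal := fun p => by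
    rw [contentIdeal_C_mul, Ideal.span_singleton_eq_top.mpr hs', Ideal.top_mul]
  rw [← hC, mul_left_comm, ← hmap, ← hC g, ← hmap, ← Polynomial.map_mul]
  simp only [contentIdeal_map_eq_map_contentIdeal]
  rw [hf, Ideal.map_mul]

/-- The powers `c(f) ^ 2 ^ k` of the content of a Gaussian polynomial are contents of Gaussian
polynomials of bounded degree. -/
theorem exists_contentIdeal_eq_pow {f : R[X]} (hf : f.IsGaussian) (k : ℕ) :
    ∃ h : R[X], h.IsGaussian ∧ h.natDegree ≤ f.natDegree ∧
      h.contentIdeal = f.contentIdeal ^ 2 ^ k := by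
  induction k with
  | zero => exact ⟨f, hf, le_rfl, by simp⟩
  | succ k ih =>
    obtain ⟨h, hh, hdeg, hc⟩ := ih
    obtain ⟨q, hq⟩ := exists_mul_comp_neg_X_eq_expand h
    refine ⟨q, of_expand two_pos (hq ▸ hh.mul hh.comp_neg_X), ?_, ?_⟩
    · have h1 := (natDegree_mul_le (p := h) (q := h.comp (-X))).trans
        (add_le_add_right (natDegree_comp_le (p := h) (q := -X)) _)
      rw [hq, natDegree_expand, natDegree_neg] at h1
      have h2 := Nat.mul_le_mul_left h.natDegree (natDegree_X_le (R := R))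
      omega
    · rw [← contentIdeal_expand q two_pos, ← hq, hh, contentIdeal_comp_neg_X, hc, ← pow_add,
        pow_succ, mul_two]

end IsGaussian

end Polynomial

/-! ### Coefficients over valuation rings and algebraic elements -/

theorem Polynomial.exists_coeff_dvd_coeff {V : Type*} [CommRing V] [IsDomain V] [ValuationRing V]
    (f : V[X]) : ∃ j, ∀ i, f.coeff j ∣ f.coeff i := by
  have key : ∀ n, ∃ j, ∀ i ≤ n, f.coeff j ∣ f.coeff i := by
    intro n
    induction n with
    | zero => exact ⟨0, fun i hi => by rw [Nat.le_zero.mp hi]⟩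
    | succ n ih =>
      obtain ⟨j, hj⟩ := ih
      rcases ValuationRing.dvd_total (f.coeff j) (f.coeff (n + 1)) with h | h
      · refine ⟨j, fun i hi => ?_⟩
        rcases Nat.le_succ_iff.mp hi with hi | rfl
        exacts [hj i hi, h]
      · refine ⟨n + 1, fun i hi => ?_⟩
        rcases Nat.le_succ_iff.mp hi with hi | rfl
        exacts [h.trans (hj i hi), dvd_rfl]
  obtain ⟨j, hj⟩ := key f.natDegree
  refine ⟨j, fun i => ?_⟩
  by_cases hi : i ≤ f.natDegree
  · exact hj i hi
  · rw [coeff_eq_zero_of_natDegree_lt (not_le.mp hi)]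
    exact dvd_zero _

/-- The `m + 1` powers lie in a space of dimension at most `m`, so they are dependent. -/
theorem isAlgebraic_of_pow_mem_span {k F : Type*} [Field k] [CommRing F] [Algebra k F] {m : ℕ}
    (b : Fin m → F) {c : F} (h : ∀ t ≤ m, c ^ t ∈ Submodule.span k (Set.range b)) :
    IsAlgebraic k c := by
  by_contra hc
  have hinj := transcendental_iff_injective.mp hc
  have hli : LinearIndependent k (fun i : Fin (m + 1) => c ^ (i : ℕ)) := by
    have h1 := ((basisMonomials k).linearIndependent.map' (aeval (R := k) c).toLinearMap
      (LinearMap.ker_eq_bot.mpr hinj)).comp (fun i : Fin (m + 1) => (i : ℕ)) Fin.val_injective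
    have h2 : (fun i : Fin (m + 1) => c ^ (i : ℕ)) =
        ((aeval (R := k) c).toLinearMap ∘ basisMonomials k) ∘ fun i : Fin (m + 1) => (i : ℕ) := by
      ext i
      simp [aeval_monomial]
    rw [h2]
    exact h1
  have h1 := finrank_span_eq_card hli
  have h2 : Submodule.span k (Set.range fun i : Fin (m + 1) => c ^ (i : ℕ)) ≤
      Submodule.span k (Set.range b) := by
    rw [Submodule.span_le]
    rintro _ ⟨i, rfl⟩
    exact h i (Nat.lt_succ_iff.mp i.2)
  have : Module.Finite k (Submodule.span k (Set.range b)) :=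
    FiniteDimensional.span_of_finite k (Set.finite_range b)
  have h3 := Submodule.finrank_mono h2
  have h4 : Module.finrank k (Submodule.span k (Set.range b)) ≤ m :=
    (finrank_range_le_card (R := k) b).trans_eq (Fintype.card_fin m)
  rw [h1, Fintype.card_fin] at h3
  omega

theorem isAlgebraic_of_root_of_isAlgebraic_coeff {k F : Type*} [Field k] [Field F] [Algebra k F]
    {p : F[X]} (hp : p ≠ 0) (hcoeff : ∀ i, IsAlgebraic k (p.coeff i)) {x : F}
    (hx : p.eval x = 0) : IsAlgebraic k x := by
  have hlift : p ∈ Polynomial.lifts (algebraMap (algebraicClosure k F) F) := by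
    rw [lifts_iff_coeff_lifts]
    exact fun i => ⟨⟨_, mem_algebraicClosure_iff.mpr (hcoeff i)⟩, rfl⟩
  obtain ⟨q, rfl⟩ := (mem_lifts _).mp hlift
  have : IsAlgebraic (algebraicClosure k F) x :=
    ⟨q, fun h => hp (by simp [h]), by simpa [aeval_def, eval_map] using hx⟩
  exact this.restrictScalars k

/-! ### Gaussian polynomials over domains -/

namespace Polynomial.IsGaussian

/-- If a valuation ring dominates a local ring `R`, then the roots in it of Gaussian polynomials
over `R` are residually algebraic. -/
theorem isAlgebraic_residue_of_root {R V : Type*} [CommRing R] [IsLocalRing R] [CommRing V]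
    [IsDomain V] [ValuationRing V] [Algebra R V] [IsLocalHom (algebraMap R V)] {f : R[X]}
    (hf : f.IsGaussian) (hf0 : f.map (algebraMap R V) ≠ 0) {x : V} (hx : aeval x f = 0) :
    IsAlgebraic (ResidueField R) (residue V x) := by
  obtain ⟨j, hj⟩ := (f.map (algebraMap R V)).exists_coeff_dvd_coeff
  set a := (f.map (algebraMap R V)).coeff j with ha
  have ha0 : a ≠ 0 := fun h => hf0 <| by
    ext i
    simpa [h] using hj i
  choose c hc using hj
  have hcj : c j = 1 := mul_left_cancel₀ ha0 (by rw [← hc, mul_one])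
  have hfac : ∃ p : V[X], f.map (algebraMap R V) = C a * p := by
    rw [← dvd_def, C_dvd_iff_dvd_coeff]
    exact fun i => ⟨_, hc i⟩
  obtain ⟨p, hp⟩ := hfac
  have hpc : ∀ i, p.coeff i = c i := fun i => by
    refine mul_left_cancel₀ ha0 ?_
    rw [← hc, hp, coeff_C_mul]
  have hpx : p.eval x = 0 := by
    have : a * p.eval x = 0 := by
      rw [aeval_def, ← eval_map, hp] at hx
      simpa using hx
    exact (mul_eq_zero.mp this).resolve_left ha0
  refine isAlgebraic_of_root_of_isAlgebraic_coeff (p := p.map (residue V)) ?_ ?_ ?_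
  · intro h
    have := congrArg (fun q => coeff q j) h
    simp [hpc, hcj] at this
  · intro i
    rw [coeff_map, hpc]
    set n := f.natDegree
    -- The exponent need only exceed `n`: `n + 1` generators must account for the `n + 2` powers `c
    -- i ^ t`, `t ≤ n + 1`.
    obtain ⟨h, -, hdeg, hcont⟩ := hf.exists_contentIdeal_eq_pow (n + 1)
    set N := 2 ^ (n + 1) with hN
    have hnN : n + 1 ≤ N := Nat.lt_two_pow_self.le
    have hle : (f.contentIdeal ^ N).map (algebraMap R V) ≤ Ideal.span {a ^ N} := by
      rw [Ideal.map_pow, ← Ideal.span_singleton_pow]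
      refine Ideal.pow_right_mono ?_ _
      rw [← contentIdeal_map_eq_map_contentIdeal, contentIdeal_le_iff]
      exact fun i => Ideal.mem_span_singleton.mpr ⟨_, hc i⟩
    have hdvd : ∀ l, a ^ N ∣ algebraMap R V (h.coeff l) := fun l =>
      Ideal.mem_span_singleton.mp (hle (Ideal.mem_map_of_mem _ (hcont ▸ h.coeff_mem_contentIdeal l)))
    choose b hb using hdvd
    refine isAlgebraic_of_pow_mem_span (m := n + 1) (fun l => residue V (b l)) fun t ht => ?_
    have hmem : f.coeff i ^ t * f.coeff j ^ (N - t) ∈ h.contentIdeal := by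
      rw [hcont, ← Nat.add_sub_cancel' (ht.trans hnN), pow_add,
        Nat.add_sub_cancel' (ht.trans hnN)]
      exact Ideal.mul_mem_mul (Ideal.pow_mem_pow (coeff_mem_contentIdeal _ _) _)
        (Ideal.pow_mem_pow (coeff_mem_contentIdeal _ _) _)
    rw [← span_coeff_eq_contentIdeal hdeg, Ideal.mem_span_range_iff_exists_fun] at hmem
    obtain ⟨r, hr⟩ := hmem
    have hpow : c i ^ t = ∑ l, algebraMap R V (r l) * b l := by
      refine mul_left_cancel₀ (pow_ne_zero N ha0) ?_
      have := congrArg (algebraMap R V) hr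
      simp only [map_sum, map_mul, map_pow, hb, ← coeff_map, ← ha] at this
      rw [hc i, mul_pow, mul_right_comm, ← pow_add, Nat.add_sub_cancel' (ht.trans hnN)] at this
      rw [← this, Finset.mul_sum]
      exact Finset.sum_congr rfl fun l _ => by ring
    rw [← map_pow, hpow, map_sum]
    refine Submodule.sum_mem _ fun l _ => ?_
    have : residue V (algebraMap R V (r l) * b l) = residue R (r l) • residue V (b l) := by
      rw [map_mul, Algebra.smul_def]
      rfl
    rw [this]
    exact Submodule.smul_mem _ _ (Submodule.subset_span ⟨l, rfl⟩)
  · rw [eval_map_apply, hpx, map_zero]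

/-- A nonzero Gaussian polynomial over a local domain divides, over the fraction field, a polynomial
with a unit coefficient. -/
theorem exists_dvd_map {R K : Type*} [CommRing R] [IsDomain R] [IsLocalRing R] [Field K]
    [Algebra R K] [IsFractionRing R K] {f : R[X]} (hf : f.IsGaussian) (hf0 : f ≠ 0) :
    ∃ N : R[X], N.map (residue R) ≠ 0 ∧ f.map (algebraMap R K) ∣ N.map (algebraMap R K) := by
  by_contra! hcon
  -- The complement of `𝔮` consists of the polynomials with a unit coefficient.
  set 𝔮 : Ideal R[X] := (maximalIdeal R).map C
  have h𝔮 : ∀ N, N ∈ 𝔮 ↔ N.map (residue R) = 0 := fun N => by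
    rw [Ideal.mem_map_C_iff, Polynomial.ext_iff]
    simp [residue_eq_zero_iff]
  have hdisj : Disjoint (Ideal.span {f.map (algebraMap R K)} : Set K[X])
      (𝔮.primeCompl.map (mapRingHom (algebraMap R K))) := by
    rw [Set.disjoint_left]
    rintro _ h1 ⟨N, hN, rfl⟩
    exact hcon N (fun h => hN ((h𝔮 N).mpr h)) (Ideal.mem_span_singleton.mp h1)
  obtain ⟨Q, hQ, hfQ, hQdisj⟩ := Ideal.exists_le_prime_disjoint _ _ hdisj
  let L := FractionRing (K[X] ⧸ Q)
  let ψ : R[X] →+* L := (algebraMap (K[X] ⧸ Q) L).comp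
    ((Ideal.Quotient.mk Q).comp (mapRingHom (algebraMap R K)))
  have hψ0 : ∀ N, ψ N = 0 ↔ N.map (algebraMap R K) ∈ Q := fun N => by
    simp only [ψ, RingHom.comp_apply, coe_mapRingHom]
    rw [map_eq_zero_iff _ (IsFractionRing.injective (K[X] ⧸ Q) L), Ideal.Quotient.eq_zero_iff_mem]
  have hψ : ∀ N : 𝔮.primeCompl, IsUnit (ψ N) := fun N => by
    rw [isUnit_iff_ne_zero, Ne, hψ0]
    exact fun h => Set.disjoint_left.mp hQdisj h ⟨N, N.2, rfl⟩
  let B := Localization.AtPrime 𝔮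
  obtain ⟨V, hV, hloc⟩ := exists_factor_valuationRing (IsLocalization.lift (S := B) hψ)
  let θ : B →+* V := (IsLocalization.lift (S := B) hψ).codRestrict V.toSubring hV
  have hθ : IsLocalHom θ := hloc
  have hθψ : ∀ N, ((θ (algebraMap R[X] B N) : V) : L) = ψ N := fun N =>
    IsLocalization.lift_eq hψ N
  let _ : Algebra R V := (θ.comp ((algebraMap R[X] B).comp C)).toAlgebra
  have halg : ∀ r, algebraMap R V r = θ (algebraMap R[X] B (C r)) := fun _ => rfl
  have : IsLocalHom (algebraMap R V) := ⟨fun r hr => by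
    rw [halg, isUnit_map_iff, IsLocalization.AtPrime.isUnit_to_map_iff B 𝔮] at hr
    by_contra h
    exact hr (Ideal.mem_map_of_mem C ((mem_maximalIdeal r).mpr h))⟩
  let x : V := θ (algebraMap R[X] B X)
  have haeval : ∀ N, aeval x N = θ (algebraMap R[X] B N) := fun N => by
    have : (aeval x : R[X] →ₐ[R] V).toRingHom = θ.comp (algebraMap R[X] B) := by
      ext r
      · simp [halg]
      · simp [x]
    exact congrArg (fun φ : R[X] →+* V => φ N) this
  have hinj : Function.Injective (algebraMap R V) := by
    rw [injective_iff_map_eq_zero]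
    intro r hr
    have h1 : ψ (C r) = 0 := by rw [← hθψ, ← halg, hr]; rfl
    rw [hψ0, map_C] at h1
    by_contra hr0
    refine hQ.ne_top (Ideal.eq_top_of_isUnit_mem _ h1 (isUnit_C.mpr ?_))
    rw [isUnit_iff_ne_zero]
    exact fun h => hr0 (IsFractionRing.injective R K (by simpa using h))
  have hroot : aeval x f = 0 := by
    rw [haeval]
    refine Subtype.ext ?_
    rw [hθψ]
    exact (hψ0 f).mpr (hfQ (Ideal.mem_span_singleton_self _))
  obtain ⟨p, hp0, hp⟩ := hf.isAlgebraic_residue_of_root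
    ((Polynomial.map_ne_zero_iff hinj).mpr hf0) hroot
  obtain ⟨N, rfl⟩ := map_surjective _ (residue_surjective (R := R)) p
  have h1 : residue V (aeval x N) = 0 := by
    rw [← hp, aeval_def, aeval_def, eval₂_map, hom_eval₂]
    rfl
  rw [haeval, residue_eq_zero_iff, mem_maximalIdeal] at h1
  -- An algebraic relation for the residue of `x` lifts to `N ∉ 𝔮`, a unit of `B`, whose image in
  -- `V` would be a nonunit.
  refine h1 ((IsLocalization.map_units B (⟨N, fun h => hp0 ((h𝔮 N).mp h)⟩ : 𝔮.primeCompl)).map θ)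

/-- The content of a Gaussian polynomial over a local domain is principal. -/
theorem contentIdeal_isPrincipal {R : Type*} [CommRing R] [IsDomain R] [IsLocalRing R] {f : R[X]}
    (hf : f.IsGaussian) : f.contentIdeal.IsPrincipal := by
  rcases eq_or_ne f 0 with rfl | hf0
  · rw [contentIdeal_zero]
    exact bot_isPrincipal
  let K := FractionRing R
  obtain ⟨N, hN, g, hg⟩ := hf.exists_dvd_map (K := K) hf0
  obtain ⟨d, hd, hgd⟩ := IsLocalization.integerNormalization_spec (nonZeroDivisors R) g
  set g' := IsLocalization.integerNormalization (nonZeroDivisors R) g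
  have hd0 : d ≠ 0 := nonZeroDivisors.ne_zero hd
  have hfg : f * g' = C d * N := by
    apply map_injective (algebraMap R K) (IsFractionRing.injective R K)
    rw [Polynomial.map_mul, Polynomial.map_mul, hgd, hg, map_C,
      ← algebraMap_smul K d g, smul_eq_C_mul, mul_left_comm]
  have hNtop : N.contentIdeal = ⊤ := by
    by_contra h
    refine hN ?_
    ext n
    simpa [residue_eq_zero_iff] using le_maximalIdeal h (N.coeff_mem_contentIdeal n)
  have hprod : f.contentIdeal * g'.contentIdeal = Ideal.span {d} := by
    rw [← hf, hfg, contentIdeal_C_mul, hNtop, Ideal.mul_top]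
  -- Otherwise every product lies in `d 𝔪`, whence `d ∈ d 𝔪`, which is absurd.
  have hex : ∃ x ∈ f.contentIdeal, ∃ y ∈ g'.contentIdeal, ∃ u, IsUnit u ∧ x * y = d * u := by
    by_contra! hcon
    have hle : Ideal.span {d} ≤ Ideal.span {d} * maximalIdeal R := by
      conv_lhs => rw [← hprod]
      rw [Ideal.mul_le]
      intro x hx y hy
      have hxy : x * y ∈ Ideal.span {d} := hprod ▸ Ideal.mul_mem_mul hx hy
      obtain ⟨u, hu⟩ := Ideal.mem_span_singleton.mp hxy
      rw [hu]
      exact Ideal.mul_mem_mul (Ideal.mem_span_singleton_self d)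
        ((mem_maximalIdeal u).mpr fun h => hcon x hx y hy u h hu)
    obtain ⟨z, hz, hdz⟩ := Ideal.mem_span_singleton_mul.mp (hle (Ideal.mem_span_singleton_self d))
    have : z = 1 := mul_left_cancel₀ hd0 (by rw [hdz, mul_one])
    exact (mem_maximalIdeal z).mp hz (this ▸ isUnit_one)
  obtain ⟨x, hx, y, hy, u, ⟨u, rfl⟩, hxy⟩ := hex
  have hy0 : y ≠ 0 := by
    rintro rfl
    rw [mul_zero] at hxy
    exact mul_ne_zero hd0 u.ne_zero hxy.symm
  refine ⟨x, le_antisymm (fun z hz => ?_) ((Ideal.span_singleton_le_iff_mem _).mpr hx)⟩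
  have hzy : z * y ∈ Ideal.span {d} := hprod ▸ Ideal.mul_mem_mul hz hy
  obtain ⟨w, hw⟩ := Ideal.mem_span_singleton.mp hzy
  refine Ideal.mem_span_singleton.mpr ⟨↑u⁻¹ * w, mul_right_cancel₀ hy0 ?_⟩
  calc z * y = d * (u * ↑u⁻¹) * w := by rw [hw, u.mul_inv, mul_one]
    _ = x * y * ↑u⁻¹ * w := by rw [hxy]; ring
    _ = x * (↑u⁻¹ * w) * y := by ring

theorem contentIdeal_isLocallyPrincipal {R : Type*} [CommRing R] [IsDomain R] {f : R[X]}
    (hf : f.IsGaussian) : f.contentIdeal.IsLocallyPrincipal := by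
  intro P _
  have : IsDomain (Localization.AtPrime P) := IsLocalization.isDomain_localization
    P.primeCompl_le_nonZeroDivisors
  rw [← contentIdeal_map_eq_map_contentIdeal]
  exact (hf.map_isLocalization P.primeCompl).contentIdeal_isPrincipal

end Polynomial.IsGaussian

/-! ### Local principality in terms of elements -/

/-- Finite generation allows one common denominator `s`, the product of those for the generators. -/
theorem Ideal.isLocallyPrincipal_iff {R : Type*} [CommRing R] {I : Ideal R} (hI : I.FG) :
    I.IsLocallyPrincipal ↔
      ∀ P : Ideal R, P.IsMaximal → ∃ s ∉ P, ∃ a ∈ I, ∀ x ∈ I, a ∣ s * x := by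
  constructor
  · intro h P hP
    obtain ⟨g, hg⟩ := h P
    rw [Ideal.submodule_span_eq] at hg
    have hgmem : g ∈ I.map (algebraMap R (Localization.AtPrime P)) :=
      hg ▸ Ideal.mem_span_singleton_self g
    obtain ⟨⟨⟨a, ha⟩, t⟩, hat⟩ := (IsLocalization.mem_map_algebraMap_iff P.primeCompl _).mp hgmem
    have hloc : ∀ x ∈ I, ∃ s ∉ P, a ∣ s * x := by
      intro x hx
      have hxmem := Ideal.mem_map_of_mem (algebraMap R (Localization.AtPrime P)) hx
      rw [hg, Ideal.mem_span_singleton] at hxmem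
      have hdvd : algebraMap R (Localization.AtPrime P) a ∣ algebraMap R _ x :=
        ((dvd_of_eq hat.symm).trans ((IsLocalization.map_units (Localization.AtPrime P)
          t).mul_right_dvd.mpr dvd_rfl)).trans hxmem
      obtain ⟨w, hw⟩ := hdvd
      obtain ⟨⟨r, u⟩, hu⟩ := IsLocalization.surj P.primeCompl w
      have heq : algebraMap R (Localization.AtPrime P) (u * x) = algebraMap R _ (a * r) := by
        rw [map_mul, map_mul, hw, ← hu]
        ring
      obtain ⟨v, hv⟩ := (IsLocalization.eq_iff_exists P.primeCompl _).mp heq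
      refine ⟨v * u, (v * u).2, v * r, ?_⟩
      rw [mul_assoc, hv]
      ring
    choose! s hsP hs using hloc
    obtain ⟨T, hT⟩ := hI
    have hTI : ∀ x ∈ T, x ∈ I := fun x hx => hT ▸ Ideal.subset_span hx
    refine ⟨∏ x ∈ T, s x, fun hmem => ?_, a, ha, fun x hx => ?_⟩
    · obtain ⟨x, hx, hxP⟩ := hP.isPrime.prod_mem_iff.mp hmem
      exact hsP x (hTI x hx) hxP
    · rw [← hT] at hx
      induction hx using Submodule.span_induction with
      | mem y hy => exact (hs y (hTI y hy)).trans (mul_dvd_mul_right (Finset.dvd_prod_of_mem s hy) y)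
      | zero => simp
      | add y z _ _ hy hz => rw [mul_add]; exact dvd_add hy hz
      | smul r y _ hy => rw [smul_eq_mul, mul_left_comm]; exact hy.mul_left r
  · intro h P hP
    obtain ⟨s, hs, a, ha, h⟩ := h P hP
    refine ⟨algebraMap R _ a, le_antisymm ?_
      ((Ideal.span_singleton_le_iff_mem _).mpr (Ideal.mem_map_of_mem _ ha))⟩
    rw [Ideal.map_le_iff_le_comap]
    intro x hx
    have h1 := map_dvd (algebraMap R (Localization.AtPrime P)) (h x hx)
    rw [map_mul] at h1
    exact Ideal.mem_span_singleton.mpr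
      ((IsLocalization.map_units _ (⟨s, hs⟩ : P.primeCompl)).dvd_mul_left.mp h1)

/-! ### Transfer between a ring and its trivial extensions -/

namespace TrivSqZeroExt

section Module

variable {A E : Type*} [CommRing A] [AddCommGroup E] [Module A E] [Module Aᵐᵒᵖ E]
  [IsCentralScalar A E]

variable (A E) in
/-- The projection of a trivial extension to its base ring. -/
def fstRingHom : TrivSqZeroExt A E →+* A := (fstHom A A E : TrivSqZeroExt A E →+* A)

@[simp]
theorem fstRingHom_apply (x : TrivSqZeroExt A E) : fstRingHom A E x = x.fst := rfl

theorem fstRingHom_surjective : Function.Surjective (fstRingHom A E) := fun a => ⟨inl a, rfl⟩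

theorem fstRingHom_comp_inlHom : (fstRingHom A E).comp (inlHom A E) = RingHom.id A := rfl

/-- Elements `(0, e)` square to zero, so they lie in every prime ideal. -/
theorem exists_eq_comap_fstRingHom (P : Ideal (TrivSqZeroExt A E)) [hP : P.IsMaximal] :
    ∃ Q : Ideal A, Q.IsMaximal ∧ P = Q.comap (fstRingHom A E) := by
  obtain ⟨Q, hQ, hPQ⟩ := (P.comap (inlHom A E)).exists_le_maximal
    (Ideal.comap_ne_top _ hP.ne_top)
  refine ⟨Q, hQ, hP.eq_of_le (Ideal.comap_ne_top _ hQ.ne_top) fun x hx => hPQ ?_⟩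
  have h1 : (inr x.snd : TrivSqZeroExt A E) ∈ P := by
    refine hP.isPrime.mem_of_pow_mem 2 ?_
    rw [pow_two, inr_mul_inr]
    exact zero_mem _
  have h2 : inlHom A E x.fst = x - inr x.snd := by
    rw [eq_sub_iff_add_eq]
    exact inl_fst_add_inr_snd_eq x
  change inlHom A E x.fst ∈ P
  rw [h2]
  exact sub_mem hx h1

end Module

section Algebra

variable {A B : Type*} [CommRing A] [CommRing B] [Algebra A B] [Module Aᵐᵒᵖ B]
  [IsCentralScalar A B]

theorem inr_one_mul (x : TrivSqZeroExt A B) :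
    inr 1 * x = inr 1 * inlHom A B (fstRingHom A B x) := by
  ext <;> simp

theorem inr_one_mul_inlHom_injective (h : Function.Injective (algebraMap A B)) {a b : A}
    (hab : (inr 1 * inlHom A B a : TrivSqZeroExt A B) = inr 1 * inlHom A B b) : a = b := by
  have := congrArg snd hab
  simp only [snd_mul, fst_inr, zero_smul, snd_inr, inlHom_apply, fst_inl, op_smul_eq_smul,
    zero_add] at this
  exact h (by simpa [Algebra.smul_def] using this)

variable (B) in
/-- The ideal `0 ∝ J` of `A ∝ B`, for an ideal `J` of `A`. -/
def inrIdeal (J : Ideal A) : Ideal (TrivSqZeroExt A B) :=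
  Ideal.span {inr 1} * J.map (inlHom A B)

theorem mem_inrIdeal {J : Ideal A} {z : TrivSqZeroExt A B} :
    z ∈ inrIdeal B J ↔ ∃ j ∈ J, inr 1 * inlHom A B j = z := by
  rw [inrIdeal, Ideal.mem_span_singleton_mul]
  constructor
  · rintro ⟨y, hy, rfl⟩
    refine ⟨fstRingHom A B y, ?_, (inr_one_mul y).symm⟩
    have := Ideal.mem_map_of_mem (fstRingHom A B) hy
    rwa [Ideal.map_map, fstRingHom_comp_inlHom, Ideal.map_id] at this
  · rintro ⟨j, hj, rfl⟩
    exact ⟨_, Ideal.mem_map_of_mem _ hj, rfl⟩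

theorem inrIdeal_injective (h : Function.Injective (algebraMap A B)) :
    Function.Injective (inrIdeal B : Ideal A → Ideal (TrivSqZeroExt A B)) := by
  have key : ∀ I J : Ideal A, inrIdeal B I = inrIdeal B J → I ≤ J := by
    intro I J hIJ x hx
    obtain ⟨y, hy, hxy⟩ := mem_inrIdeal.mp (hIJ ▸ mem_inrIdeal.mpr ⟨x, hx, rfl⟩)
    exact inr_one_mul_inlHom_injective h hxy ▸ hy
  exact fun I J hIJ => le_antisymm (key I J hIJ) (key J I hIJ.symm)

theorem inrIdeal_mul (J : Ideal A) (G : Ideal (TrivSqZeroExt A B)) :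
    inrIdeal B J * G = inrIdeal B (J * G.map (fstRingHom A B)) := by
  apply le_antisymm
  · rw [Ideal.mul_le]
    intro z hz x hx
    obtain ⟨j, hj, rfl⟩ := mem_inrIdeal.mp hz
    refine mem_inrIdeal.mpr ⟨j * fstRingHom A B x,
      Ideal.mul_mem_mul hj (Ideal.mem_map_of_mem _ hx), ?_⟩
    rw [map_mul, mul_left_comm, ← inr_one_mul]
    ring
  · have hG : inrIdeal B (G.map (fstRingHom A B)) ≤ Ideal.span {inr 1} * G := by
      intro z hz
      obtain ⟨j, hj, rfl⟩ := mem_inrIdeal.mp hz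
      obtain ⟨x, hx, rfl⟩ := (Ideal.mem_map_iff_of_surjective (fstRingHom A B) fstRingHom_surjective).mp hj
      rw [← inr_one_mul]
      exact Ideal.mul_mem_mul (Ideal.mem_span_singleton_self _) hx
    calc inrIdeal B (J * G.map (fstRingHom A B))
        = J.map (inlHom A B) * inrIdeal B (G.map (fstRingHom A B)) := by
          rw [inrIdeal, inrIdeal, Ideal.map_mul, mul_left_comm]
      _ ≤ J.map (inlHom A B) * (Ideal.span {inr 1} * G) := Ideal.mul_mono_right hG
      _ = inrIdeal B J * G := by rw [inrIdeal]; ring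

variable (B) in
/-- The polynomial `(0, f)` over `A ∝ B`, for a polynomial `f` over `A`. -/
noncomputable def inrPolynomial (f : A[X]) : (TrivSqZeroExt A B)[X] :=
  C (inr 1) * f.map (inlHom A B)

theorem coeff_inrPolynomial (f : A[X]) (n : ℕ) :
    (inrPolynomial B f).coeff n = inr (algebraMap A B (f.coeff n)) := by
  rw [inrPolynomial, coeff_C_mul, coeff_map]
  ext <;> simp [Algebra.smul_def]

theorem contentIdeal_inrPolynomial (f : A[X]) :
    (inrPolynomial B f).contentIdeal = inrIdeal B f.contentIdeal := by
  rw [inrPolynomial, contentIdeal_C_mul, contentIdeal_map_eq_map_contentIdeal, inrIdeal]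

theorem inrPolynomial_mul (f : A[X]) (G : (TrivSqZeroExt A B)[X]) :
    inrPolynomial B f * G = inrPolynomial B (f * G.map (fstRingHom A B)) := by
  have hG : C (inr 1) * G = C (inr 1) * (G.map (fstRingHom A B)).map (inlHom A B) := by
    ext1 n
    simpa only [coeff_C_mul, coeff_map] using inr_one_mul (G.coeff n)
  rw [inrPolynomial, inrPolynomial, Polynomial.map_mul, mul_left_comm, ← hG]
  ring

theorem isGaussian_inrPolynomial_iff (h : Function.Injective (algebraMap A B)) {f : A[X]} :
    (inrPolynomial B f).IsGaussian ↔ f.IsGaussian := by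
  have key : ∀ G : (TrivSqZeroExt A B)[X], (inrPolynomial B f * G).contentIdeal =
      (inrPolynomial B f).contentIdeal * G.contentIdeal ↔
      (f * G.map (fstRingHom A B)).contentIdeal =
        f.contentIdeal * (G.map (fstRingHom A B)).contentIdeal := fun G => by
    rw [inrPolynomial_mul, contentIdeal_inrPolynomial, contentIdeal_inrPolynomial, inrIdeal_mul,
      (inrIdeal_injective h).eq_iff, contentIdeal_map_eq_map_contentIdeal]
  refine ⟨fun hf g => ?_, fun hf G => (key G).mpr (hf _)⟩
  obtain ⟨G, rfl⟩ := map_surjective _ (fstRingHom_surjective (E := B)) g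
  exact (key G).mp (hf G)

theorem isLocallyPrincipal_inrPolynomial_iff (h : Function.Injective (algebraMap A B)) {f : A[X]} :
    (inrPolynomial B f).contentIdeal.IsLocallyPrincipal ↔ f.contentIdeal.IsLocallyPrincipal := by
  rw [Ideal.isLocallyPrincipal_iff (contentIdeal_FG _),
    Ideal.isLocallyPrincipal_iff (contentIdeal_FG _), contentIdeal_inrPolynomial]
  have hmul : ∀ (s : TrivSqZeroExt A B) (j : A),
      s * (inr 1 * inlHom A B j) = inr 1 * inlHom A B (fstRingHom A B s * j) := fun s j => by
    rw [mul_left_comm, ← mul_assoc, inr_one_mul s, map_mul, mul_assoc]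
  constructor
  · intro H P hP
    have hP' := Ideal.comap_isMaximal_of_surjective (fstRingHom A B) fstRingHom_surjective (K := P)
    obtain ⟨s, hs, z, hz, H⟩ := H _ hP'
    obtain ⟨a, ha, rfl⟩ := mem_inrIdeal.mp hz
    refine ⟨fstRingHom A B s, hs, a, ha, fun j hj => ?_⟩
    obtain ⟨r, hr⟩ := H _ (mem_inrIdeal.mpr ⟨j, hj, rfl⟩)
    rw [mul_comm _ r, hmul, hmul] at hr
    exact ⟨_, (inr_one_mul_inlHom_injective h hr).trans (mul_comm _ _)⟩
  · intro H P hP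
    obtain ⟨Q, hQ, rfl⟩ := exists_eq_comap_fstRingHom P
    obtain ⟨s, hs, a, ha, H⟩ := H Q hQ
    refine ⟨inlHom A B s, hs, _, mem_inrIdeal.mpr ⟨a, ha, rfl⟩, fun x hx => ?_⟩
    obtain ⟨j, hj, rfl⟩ := mem_inrIdeal.mp hx
    obtain ⟨r, hr⟩ := H j hj
    refine ⟨inlHom A B r, ?_⟩
    rw [mul_left_comm, ← map_mul, hr, map_mul, mul_assoc]

end Algebra

/-! ### Trivial extension by the fraction field -/

section FractionField

variable {A K : Type*} [CommRing A] [IsDomain A] [Field K] [Algebra A K] [IsFractionRing A K]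
  [Module Aᵐᵒᵖ K] [IsCentralScalar A K]

theorem isLocallyPrincipal_of_map_fstRingHom_ne_bot {I : Ideal (TrivSqZeroExt A K)} (hI : I.FG)
    (h0 : I.map (fstRingHom A K) ≠ ⊥) (h : (I.map (fstRingHom A K)).IsLocallyPrincipal) :
    I.IsLocallyPrincipal := by
  rw [Ideal.isLocallyPrincipal_iff hI]
  rw [Ideal.isLocallyPrincipal_iff (hI.map _)] at h
  intro P hP
  obtain ⟨Q, hQ, rfl⟩ := exists_eq_comap_fstRingHom P
  obtain ⟨s, hs, a, ha, H⟩ := h Q hQ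
  have hs0 : s ≠ 0 := fun h => hs (h ▸ zero_mem Q)
  have ha0 : algebraMap A K a ≠ 0 := by
    rw [Ne, map_eq_zero_iff _ (IsFractionRing.injective A K)]
    rintro rfl
    refine h0 ((Submodule.eq_bot_iff _).mpr fun x hx => ?_)
    exact (mul_eq_zero.mp (zero_dvd_iff.mp (H x hx))).resolve_left hs0
  obtain ⟨α, hα, rfl⟩ := (Ideal.mem_map_iff_of_surjective (fstRingHom A K) fstRingHom_surjective).mp ha
  refine ⟨inl s, hs, α, hα, fun x hx => ?_⟩
  obtain ⟨r, hr⟩ := H _ (Ideal.mem_map_of_mem _ hx)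
  -- The second coordinate `e` solves `s x₂ = r α₂ + α₁ e`; division by `α₁ ≠ 0` is possible in `K`.
  refine ⟨inl r + inr ((s • x.snd - r • α.snd) / algebraMap A K α.fst), ?_⟩
  rw [fstRingHom_apply] at ha0
  ext
  · simpa using hr
  · simp only [snd_mul, fst_inl, snd_inl, snd_add, fst_add, fst_inr, snd_inr, op_smul_eq_smul,
      smul_zero, add_zero, zero_add]
    rw [Algebra.smul_def α.fst, mul_div_cancel₀ _ ha0]
    abel

theorem exists_C_mul_eq_inrPolynomial {F : (TrivSqZeroExt A K)[X]}
    (hF : F.map (fstRingHom A K) = 0) :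
    ∃ d : A, d ≠ 0 ∧ ∃ f : A[X], C (inl d) * F = inrPolynomial K f := by
  obtain ⟨⟨d, hd⟩, H⟩ := IsLocalization.exist_integer_multiples (nonZeroDivisors A) F.support
    fun n => (F.coeff n).snd
  choose! a ha using H
  refine ⟨d, nonZeroDivisors.ne_zero hd, ∑ n ∈ F.support, monomial n (a n), ?_⟩
  ext1 n
  rw [coeff_C_mul, coeff_inrPolynomial, finsetSum_coeff]
  simp only [coeff_monomial, Finset.sum_ite_eq']
  have hfst : (F.coeff n).fst = 0 := by simpa using congrArg (fun p => coeff p n) hF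
  split_ifs with hn
  · rw [ha n hn]
    ext <;> simp [hfst]
  · simp [notMem_support_iff.mp hn]

/-- Multiplication by `inl d` is injective since `d` is nonzero in both `A` and `K`, so
divisibilities can be cancelled. -/
theorem isLocallyPrincipal_of_span_inl_mul {I : Ideal (TrivSqZeroExt A K)} (hI : I.FG) {d : A}
    (hd : d ≠ 0) (h : (Ideal.span {inl d} * I).IsLocallyPrincipal) : I.IsLocallyPrincipal := by
  have hcancel : ∀ x y : TrivSqZeroExt A K, inl d * x = inl d * y → x = y := by
    intro x y hxy
    have hd' : algebraMap A K d ≠ 0 := by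
      rwa [Ne, map_eq_zero_iff _ (IsFractionRing.injective A K)]
    have h1 := congrArg fst hxy
    have h2 := congrArg snd hxy
    simp only [fst_mul, fst_inl, snd_mul, snd_inl, smul_zero, add_zero, Algebra.smul_def] at h1 h2
    exact TrivSqZeroExt.ext (mul_left_cancel₀ hd h1) (mul_left_cancel₀ hd' h2)
  rw [Ideal.isLocallyPrincipal_iff hI]
  rw [Ideal.isLocallyPrincipal_iff (Submodule.FG.mul (Submodule.fg_span_singleton _) hI)] at h
  intro P hP
  obtain ⟨s, hs, z, hz, H⟩ := h P hP
  obtain ⟨a, ha, rfl⟩ := Ideal.mem_span_singleton_mul.mp hz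
  refine ⟨s, hs, a, ha, fun x hx => ?_⟩
  obtain ⟨r, hr⟩ := H _ (Ideal.mul_mem_mul (Ideal.mem_span_singleton_self _) hx)
  exact ⟨r, hcancel _ _ (by rw [mul_left_comm, hr, mul_assoc])⟩

theorem isPseudoArithmetical_fractionField : IsPseudoArithmetical (TrivSqZeroExt A K) := by
  intro F hF
  by_cases h0 : F.map (fstRingHom A K) = 0
  · obtain ⟨d, hd, f, hf⟩ := exists_C_mul_eq_inrPolynomial h0
    have hinj := IsFractionRing.injective A K
    have hG : f.IsGaussian := (isGaussian_inrPolynomial_iff hinj).mp (hf ▸ hF.C_mul (inl d))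
    refine isLocallyPrincipal_of_span_inl_mul (contentIdeal_FG F) hd ?_
    rw [← contentIdeal_C_mul, hf]
    exact (isLocallyPrincipal_inrPolynomial_iff hinj).mpr hG.contentIdeal_isLocallyPrincipal
  · have hG := hF.map_of_surjective _ (fstRingHom_surjective (A := A) (E := K))
    refine isLocallyPrincipal_of_map_fstRingHom_ne_bot (contentIdeal_FG F) ?_ ?_ <;>
      rw [← contentIdeal_map_eq_map_contentIdeal]
    · exact (contentIdeal_eq_bot_iff _).not.mpr h0
    · exact hG.contentIdeal_isLocallyPrincipal

end FractionField

theorem isPseudoArithmetical_of_injective {A B : Type*} [CommRing A] [CommRing B] [Algebra A B]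
    [Module Aᵐᵒᵖ B] [IsCentralScalar A B] (h : Function.Injective (algebraMap A B))
    (hAB : IsPseudoArithmetical (TrivSqZeroExt A B)) : IsPseudoArithmetical A := fun _ hf =>
  (isLocallyPrincipal_inrPolynomial_iff h).mp (hAB _ ((isGaussian_inrPolynomial_iff h).mpr hf))

end TrivSqZeroExt

/-- The trivial ring extension of `A` by `E` is `TrivSqZeroExt A E`. The instances `Module Aᵐᵒᵖ E`
and `IsCentralScalar A E`, which Mathlib asks for, only say that the right action of `A` on `E`
is the left action, so that `(a, e) * (a', e') = (a * a', a • e' + a' • e)`. -/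
theorem theorem4p2 :
    (∀ (A K : Type*) [CommRing A] [IsDomain A] [Field K] [Algebra A K] [IsFractionRing A K]
        [Module Aᵐᵒᵖ K] [IsCentralScalar A K],
      IsPseudoArithmetical (TrivSqZeroExt A K)) ∧
    (∀ (A B : Type*) [CommRing A] [CommRing B] [Algebra A B]
        [Module Aᵐᵒᵖ B] [IsCentralScalar A B],
      Function.Injective (algebraMap A B) →
      IsPseudoArithmetical (TrivSqZeroExt A B) → IsPseudoArithmetical A) := by
  exact ⟨fun _ _ => TrivSqZeroExt.isPseudoArithmetical_fractionField,
    fun _ _ => TrivSqZeroExt.isPseudoArithmetical_of_injective⟩
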